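/- Rings are associative and unital. For a ring $R$ whose additive group is finitely generated and torsion-free, write $\mathbb{Q}R=\mathbb{Q}\otimes_{\mathbb{Z}}R\supseteq R$, and let $R^\times$ be the monoid of left regular elements of $R$, i.e. of those $a\in R$ for which $x\mapsto ax$ is injective; these are invertible in $\mathbb{Q}R$. For a submonoid $M\subseteq R^\times$, let $\langle M\rangle$ be the subgroup of the unit group $(\mathbb{Q}R)^*$ generated by $M$. Let $\mathcal{L}\subseteq R$ be an additive subgroup with $a\mathcal{L}\subseteq\mathcal{L}$ for all $a\in M$. Let $\mathcal{C}$ be the smallest family of subgroups of $\mathcal{L}$ that contains $\mathcal{L}$ and that contains $aC$ and $\{x\in\mathcal{L}: ax\in C\}$ whenever $a\in M$ and $C\in\mathcal{C}$, and let $\overline{\mathcal{L}}=\varprojlim_{C\in\mathcal{C}}\mathcal{L}/C$, with the inverse limit topology of the discrete groups $\mathcal{L}/C$. The group $\mathbb{Q}R\rtimes\langle M\rangle$ acts on $\mathbb{Q}R$ by $(z,\gamma).x=z+\gamma x$. Each $g$ in this group restricts to a partial bijection $\mathcal{L}\cap g^{-1}.\mathcal{L}\to g.\mathcal{L}\cap\mathcal{L}$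 of $\mathcal{L}$, which extends uniquely to a partial homeomorphism of $\overline{\mathcal{L}}$ whose domain $U_{g^{-1}}$ is the closure of the image of $\mathcal{L}\cap g^{-1}.\mathcal{L}$. Let $$(\mathbb{Q}R\rtimes\langle M\rangle)\ltimes\overline{\mathcal{L}}=\{(g,\boldsymbol{x}) : \boldsymbol{x}\in U_{g^{-1}}\}$$ be the associated partial transformation groupoid, with product $(g,h.\boldsymbol{x})(h,\boldsymbol{x})=(gh,\boldsymbol{x})$ and with the subspace topology from the product of the discrete group $\mathbb{Q}R\rtimes\langle M\rangle$ with $\overline{\mathcal{L}}$. Theorem. For $i=1,2$, let $R_i$ be a ring whose additive group is finitely generated and torsion-free, such that $\mathbb{Q}R_i$ is a semisimple $\mathbb{Q}$-algebra (i.e. its Jacobson radical is zero). (1) For $i=1,2$, let $M_i\subseteq R_i^\times$ be a submonoid such that $\operatorname{span}_{\mathbb{Z}}(M_i)$ has finite index in $R_i$ and such that $M_i$ contains (the image of) an integer $\kappa_i\in\mathbb{Z}\setminus\{0,1\}$, and let $\mathcal{L}_i\subseteq R_i$ be an $M_i$-invariant subgroup of full rank. If there is an isomorphism of topological groupoids $$(\mathbb{Q}R_1\rtimes\langle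 M_1\rangle)\ltimes\overline{\mathcal{L}}_1\cong(\mathbb{Q}R_2\rtimes\langle M_2\rangle)\ltimes\overline{\mathcal{L}}_2,$$ then there are $\mathbb{Q}$-algebra isomorphisms $\varphi_1\colon\mathbb{Q}R_1\to\mathbb{Q}R_2$ and $\varphi_2\colon\mathbb{Q}R_2\to\mathbb{Q}R_1$ with $\varphi_1(\langle M_1\rangle)\subseteq\langle M_2\rangle$ and $\varphi_2(\langle M_2\rangle)\subseteq\langle M_1\rangle$. (2) If there is an isomorphism of topological groupoids between those obtained from $M_i=R_i^\times$ and $\mathcal{L}_i=R_i$ for $i=1,2$ (here $\langle R_i^\times\rangle=(\mathbb{Q}R_i)^*$), i.e. $$(\mathbb{Q}R_1\rtimes(\mathbb{Q}R_1)^*)\ltimes\overline{R}_1\cong(\mathbb{Q}R_2\rtimes(\mathbb{Q}R_2)^*)\ltimes\overline{R}_2,$$ then $\mathbb{Q}R_1$ and $\mathbb{Q}R_2$ are isomorphic as $\mathbb{Q}$-algebras. -/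

import Mathlib

open scoped TensorProduct

namespace AlgAct

/-! ### Algebraic actions, constructible subgroups, completions -/

/-- An algebraic action of a monoid `S` on an abelian group `A` by injective endomorphisms,
presented inside a globalization: `S` is a submonoid of a group `H` which acts by automorphisms on
an abelian group `V`, and `A` is an `S`-invariant subgroup of `V`. -/
structure AlgebraicAction (H V : Type*) [Group H] [AddCommGroup V] [DistribMulAction H V] where
  /-- the acting monoid -/
  S : Submonoid H
  /-- the group acted upon -/
  A : AddSubgroup V
  smul_mem : ∀ s ∈ S, ∀ a ∈ A, s • a ∈ A

namespace AlgebraicAction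

variable {H V : Type*} [Group H] [AddCommGroup V] [DistribMulAction H V]
variable (σ : AlgebraicAction H V)

/-- The `S`-constructible subgroups of `A`: the smallest family of subgroups which contains `A` and
is closed under `C ↦ s C` and `C ↦ s⁻¹ C = {a ∈ A | s a ∈ C}` for `s ∈ S`. -/
inductive IsConstructible : AddSubgroup V → Prop
  | base : IsConstructible σ.A
  | image (s : H) (hs : s ∈ σ.S) (C : AddSubgroup V) (hC : IsConstructible C) :
      IsConstructible (C.map (DistribSMul.toAddMonoidHom V s))
  | preimage (s : H) (hs : s ∈ σ.S) (C : AddSubgroup V) (hC : IsConstructible C) :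
      IsConstructible (σ.A ⊓ C.comap (DistribSMul.toAddMonoidHom V s))

/-- The completion `lim A / C` of `A`, over the constructible subgroups `C` ordered by inclusion,
as the set of compatible families `(x_C)` of cosets. -/
@[ext]
structure Completion where
  /-- the coset `x_C` -/
  coset : ∀ C : {C : AddSubgroup V // σ.IsConstructible C}, σ.A ⧸ C.1.addSubgroupOf σ.A
  compat : ∀ C D : {C : AddSubgroup V // σ.IsConstructible C}, C.1 ≤ D.1 →
    ∀ a : σ.A, coset C = QuotientAddGroup.mk a → coset D = QuotientAddGroup.mk a

/-- The inverse limit topology: the coarsest one for which the projections to the discrete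
quotients `A / C` are continuous. -/
instance : TopologicalSpace σ.Completion :=
  ⨅ C, TopologicalSpace.induced (fun x => x.coset C) ⊥

/-- The canonical map from `A` to its completion. -/
def toCompletion (a : σ.A) : σ.Completion :=
  ⟨fun _ => QuotientAddGroup.mk a, fun C D hCD b hb => by
    rw [QuotientAddGroup.eq] at hb ⊢
    exact hCD hb⟩

/-! ### The partial action on the completion -/

/-- The enveloping group `⟨S⟩` of `S`. -/
abbrev gp : Subgroup H := Subgroup.closure (σ.S : Set H)

/-- The action of `⟨S⟩` on `V`, with `V` written multiplicatively. -/
def actionHom : σ.gp →* MulAut (Multiplicative V) where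
  toFun γ := AddEquiv.toMultiplicative (DistribMulAction.toAddEquiv V (γ : H))
  map_one' := MulEquiv.ext fun v => one_smul H (Multiplicative.toAdd v)
  map_mul' γ δ := MulEquiv.ext fun v => mul_smul (γ : H) (δ : H) (Multiplicative.toAdd v)

/-- The semidirect product `V ⋊ ⟨S⟩`; its elements are pairs `(z, γ)`. -/
abbrev AffGroup : Type _ :=
  Multiplicative V ⋊[σ.actionHom] σ.gp

variable {σ}

/-- The affine action `(z, γ).v = z + γ v` of `V ⋊ ⟨S⟩` on `V`. -/
def affine (g : σ.AffGroup) (v : V) : V :=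
  Multiplicative.toAdd g.left + (g.right : H) • v

/-- The relation `g.x = y` for the partial action of `V ⋊ ⟨S⟩` on the completion of `A`. An element
`g` acts on `A` by the partial bijection `A ∩ g⁻¹.A → g.A ∩ A`, `a ↦ g.a`; the graph of its
extension to the completion is the closure of the graph of this partial bijection. The domain of
the extension is the closure of `A ∩ g⁻¹.A` (`exists_acts_iff`), it is a well defined map there
(`Acts.unique`), and it extends the partial bijection (`acts_toCompletion`). -/
def Acts (g : σ.AffGroup) (x y : σ.Completion) : Prop :=
  (x, y) ∈ closure {p : σ.Completion × σ.Completion |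
    ∃ a b : σ.A, (b : V) = affine g (a : V) ∧ p = (σ.toCompletion a, σ.toCompletion b)}

theorem affine_one (v : V) : affine (1 : σ.AffGroup) v = v := by
  simp [affine]

theorem affine_mul (g h : σ.AffGroup) (v : V) : affine (g * h) v = affine g (affine h v) := by
  simp only [affine, SemidirectProduct.mul_left, SemidirectProduct.mul_right, smul_add, toAdd_mul,
    Subgroup.coe_mul, mul_smul, add_assoc]
  rfl

theorem affine_sub (g : σ.AffGroup) (v w : V) :
    affine g v - affine g w = (g.right : H) • (v - w) := by
  simp [affine, smul_sub]

theorem IsConstructible.le {C : AddSubgroup V} (hC : σ.IsConstructible C) : C ≤ σ.A := by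
  induction hC with
  | base => exact le_rfl
  | image s hs C _ ih =>
    rintro _ ⟨c, hc, rfl⟩
    exact σ.smul_mem s hs c (ih hc)
  | preimage s hs C _ ih => exact inf_le_left

theorem IsConstructible.inf {C D : AddSubgroup V} (hC : σ.IsConstructible C)
    (hD : σ.IsConstructible D) : σ.IsConstructible (C ⊓ D) := by
  induction hC generalizing D with
  | base => rwa [inf_eq_right.2 hD.le]
  | image s hs C hC ih =>
    convert IsConstructible.image s hs _ (ih (IsConstructible.preimage s hs D hD)) using 1
    ext v
    constructor
    · rintro ⟨⟨c, hc, rfl⟩, hv⟩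
      exact ⟨c, ⟨hc, hC.le hc, hv⟩, rfl⟩
    · rintro ⟨c, ⟨hc, -, hv⟩, rfl⟩
      exact ⟨⟨c, hc, rfl⟩, hv⟩
  | preimage s hs C hC ih =>
    convert IsConstructible.preimage s hs _ (ih (IsConstructible.image s hs D hD)) using 1
    ext v
    constructor
    · rintro ⟨⟨hA, hv⟩, hvD⟩
      exact ⟨hA, hv, v, hvD, rfl⟩
    · rintro ⟨hA, hv, w, hw, hwv⟩
      have : w = v := MulAction.injective s hwv
      exact ⟨⟨hA, hv⟩, this ▸ hw⟩

/-- Every `γ ∈ ⟨S⟩` maps some constructible subgroup into any given one. -/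
theorem exists_smul_mem (γ : H) (hγ : γ ∈ σ.gp) {C : AddSubgroup V} (hC : σ.IsConstructible C) :
    ∃ D, σ.IsConstructible D ∧ ∀ d ∈ D, γ • d ∈ C := by
  suffices h : (∀ C, σ.IsConstructible C → ∃ D, σ.IsConstructible D ∧ ∀ d ∈ D, γ • d ∈ C) ∧
      (∀ C, σ.IsConstructible C → ∃ D, σ.IsConstructible D ∧ ∀ d ∈ D, γ⁻¹ • d ∈ C) from h.1 C hC
  clear hC C
  induction hγ using Subgroup.closure_induction with
  | mem s hs =>
    refine ⟨fun C hC => ⟨_, .preimage s hs C hC, fun d hd => hd.2⟩,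
      fun C hC => ⟨_, .image s hs C hC, ?_⟩⟩
    rintro _ ⟨c, hc, rfl⟩
    simpa using hc
  | one => exact ⟨fun C hC => ⟨C, hC, by simp⟩, fun C hC => ⟨C, hC, by simp⟩⟩
  | mul a b _ _ iha ihb =>
    constructor
    · intro C hC
      obtain ⟨D, hD, h⟩ := iha.1 C hC
      obtain ⟨E, hE, h'⟩ := ihb.1 D hD
      exact ⟨E, hE, fun e he => by rw [mul_smul]; exact h _ (h' _ he)⟩
    · intro C hC
      obtain ⟨D, hD, h⟩ := ihb.2 C hC
      obtain ⟨E, hE, h'⟩ := iha.2 D hD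
      exact ⟨E, hE, fun e he => by rw [mul_inv_rev, mul_smul]; exact h _ (h' _ he)⟩
  | inv a _ ih => exact ⟨ih.2, by simpa using ih.1⟩

theorem mk_eq_mk {C : AddSubgroup V} {a b : σ.A} :
    (QuotientAddGroup.mk a : σ.A ⧸ C.addSubgroupOf σ.A) = QuotientAddGroup.mk b ↔
      (b : V) - a ∈ C := by
  rw [QuotientAddGroup.eq, AddSubgroup.mem_addSubgroupOf]
  simp [sub_eq_neg_add]

/-- The sets `{y | y_C = x_C}` form a neighbourhood basis at `x`. -/
theorem nhds_hasBasis (x : σ.Completion) :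
    (nhds x).HasBasis (fun _ : {C : AddSubgroup V // σ.IsConstructible C} => True)
      (fun C => {y | y.coset C = x.coset C}) := by
  have h1 : nhds x = ⨅ C : {C : AddSubgroup V // σ.IsConstructible C},
      Filter.principal {y : σ.Completion | y.coset C = x.coset C} := by
    rw [nhds_iInf]
    refine iInf_congr fun C => ?_
    let _ : TopologicalSpace (σ.A ⧸ C.1.addSubgroupOf σ.A) := ⊥
    have : DiscreteTopology (σ.A ⧸ C.1.addSubgroupOf σ.A) := ⟨rfl⟩
    rw [nhds_induced, nhds_discrete, Filter.comap_pure]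
    rfl
  rw [h1]
  have : Nonempty {C : AddSubgroup V // σ.IsConstructible C} := ⟨⟨_, .base⟩⟩
  refine Filter.hasBasis_iInf_principal ?_
  intro C D
  refine ⟨⟨C.1 ⊓ D.1, C.2.inf D.2⟩, ?_, ?_⟩
  · intro y hy
    obtain ⟨a, ha⟩ := QuotientAddGroup.mk_surjective (x.coset ⟨C.1 ⊓ D.1, C.2.inf D.2⟩)
    have hy' : y.coset ⟨C.1 ⊓ D.1, C.2.inf D.2⟩ = QuotientAddGroup.mk a := by rw [ha]; exact hy
    exact (y.compat _ C inf_le_left a hy').trans (x.compat _ C inf_le_left a ha.symm).symm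
  · intro y hy
    obtain ⟨a, ha⟩ := QuotientAddGroup.mk_surjective (x.coset ⟨C.1 ⊓ D.1, C.2.inf D.2⟩)
    have hy' : y.coset ⟨C.1 ⊓ D.1, C.2.inf D.2⟩ = QuotientAddGroup.mk a := by rw [ha]; exact hy
    exact (y.compat _ D inf_le_right a hy').trans (x.compat _ D inf_le_right a ha.symm).symm

theorem acts_iff {g : σ.AffGroup} {x y : σ.Completion} :
    Acts g x y ↔ ∀ C : {C : AddSubgroup V // σ.IsConstructible C}, ∃ a b : σ.A,
      (b : V) = affine g (a : V) ∧ x.coset C = QuotientAddGroup.mk a ∧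
        y.coset C = QuotientAddGroup.mk b := by
  rw [Acts, mem_closure_iff_nhds_basis ((nhds_hasBasis x).prod_nhds (nhds_hasBasis y))]
  constructor
  · intro h C
    obtain ⟨_, ⟨a, b, hab, rfl⟩, h1, h2⟩ := h (C, C) ⟨trivial, trivial⟩
    exact ⟨a, b, hab, h1.symm, h2.symm⟩
  · rintro h ⟨C, D⟩ -
    obtain ⟨a, b, hab, h1, h2⟩ := h ⟨C.1 ⊓ D.1, C.2.inf D.2⟩
    exact ⟨_, ⟨a, b, hab, rfl⟩, (x.compat _ C inf_le_left a h1).symm, (y.compat _ D inf_le_right b h2).symm⟩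

theorem acts_toCompletion {g : σ.AffGroup} {a b : σ.A} (h : (b : V) = affine g (a : V)) :
    Acts g (σ.toCompletion a) (σ.toCompletion b) :=
  subset_closure ⟨a, b, h, rfl⟩

theorem Acts.unique {g : σ.AffGroup} {x y y' : σ.Completion} (h : Acts g x y)
    (h' : Acts g x y') : y = y' := by
  rw [acts_iff] at h h'
  refine Completion.ext (funext fun C => ?_)
  obtain ⟨D, hD, hDC⟩ := exists_smul_mem (g.right : H) g.right.2 C.2
  obtain ⟨a, b, hab, h1, h2⟩ := h ⟨C.1 ⊓ D, C.2.inf hD⟩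
  obtain ⟨a', b', hab', h1', h2'⟩ := h' ⟨C.1 ⊓ D, C.2.inf hD⟩
  rw [y.compat _ C inf_le_left b h2, y'.compat _ C inf_le_left b' h2', mk_eq_mk, hab, hab', affine_sub]
  exact hDC _ (mk_eq_mk.1 (h1.symm.trans h1')).2

theorem exists_acts_iff {g : σ.AffGroup} {x : σ.Completion} :
    (∃ y, Acts g x y) ↔ x ∈ closure (σ.toCompletion '' {a : σ.A | affine g (a : V) ∈ σ.A}) := by
  rw [mem_closure_iff_nhds_basis (nhds_hasBasis x)]
  constructor
  · rintro ⟨y, hy⟩ C -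
    obtain ⟨a, b, hab, h1, -⟩ := acts_iff.1 hy C
    exact ⟨_, ⟨a, by rw [Set.mem_ofPred_eq, ← hab]; exact b.2, rfl⟩, h1.symm⟩
  · intro h
    have key : ∀ C : {C : AddSubgroup V // σ.IsConstructible C},
        ∃ D : {C : AddSubgroup V // σ.IsConstructible C}, D.1 ≤ C.1 ∧
          ∀ d ∈ D.1, (g.right : H) • d ∈ C.1 := fun C => by
      obtain ⟨D, hD, hDC⟩ := exists_smul_mem (g.right : H) g.right.2 C.2
      exact ⟨⟨C.1 ⊓ D, C.2.inf hD⟩, inf_le_left, fun d hd => hDC d hd.2⟩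
    choose D hDC hD using key
    have h' : ∀ C : {C : AddSubgroup V // σ.IsConstructible C}, ∃ a b : σ.A,
        (b : V) = affine g (a : V) ∧ x.coset C = QuotientAddGroup.mk a := fun C => by
      obtain ⟨_, ⟨a, ha, rfl⟩, h1⟩ := h C trivial
      exact ⟨a, ⟨_, ha⟩, rfl, Eq.symm h1⟩
    choose a b hab ha using h'
    have hb : ∀ C E : {C : AddSubgroup V // σ.IsConstructible C}, C.1 ≤ E.1 →
        (b (D E) : V) - b (D C) ∈ E.1 := fun C E hCE => by
      obtain ⟨F, hF⟩ : ∃ F : {C : AddSubgroup V // σ.IsConstructible C},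
          F.1 ≤ (D C).1 ∧ F.1 ≤ (D E).1 :=
        ⟨⟨_, (D C).2.inf (D E).2⟩, inf_le_left, inf_le_right⟩
      have e1 := mk_eq_mk.1 ((x.compat F (D C) hF.1 _ (ha F)).symm.trans (ha (D C)))
      have e2 := mk_eq_mk.1 ((x.compat F (D E) hF.2 _ (ha F)).symm.trans (ha (D E)))
      have e3 := hCE (hD C _ e1)
      have e4 := hD E _ e2
      rw [← affine_sub, ← hab, ← hab] at e3 e4
      simpa using E.1.sub_mem e4 e3
    refine ⟨⟨fun C => QuotientAddGroup.mk (b (D C)), fun C E hCE c hc => ?_⟩, ?_⟩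
    · rw [mk_eq_mk] at hc ⊢
      have := E.1.sub_mem (hCE hc) (hb C E hCE)
      simpa using this
    · rw [acts_iff]
      intro C
      exact ⟨a (D C), b (D C), hab _, x.compat (D C) C (hDC C) _ (ha _), rfl⟩

theorem Acts.refl (x : σ.Completion) : Acts (1 : σ.AffGroup) x x := by
  rw [acts_iff]
  intro C
  obtain ⟨a, ha⟩ := QuotientAddGroup.mk_surjective (x.coset C)
  exact ⟨a, a, (affine_one _).symm, ha.symm, ha.symm⟩

theorem Acts.inv {g : σ.AffGroup} {x y : σ.Completion} (h : Acts g x y) : Acts g⁻¹ y x := by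
  rw [acts_iff] at h ⊢
  intro C
  obtain ⟨a, b, hab, h1, h2⟩ := h C
  exact ⟨b, a, by rw [hab, ← affine_mul, inv_mul_cancel, affine_one], h2, h1⟩

theorem Acts.mul {g h : σ.AffGroup} {x y w : σ.Completion} (hg : Acts g y w) (hh : Acts h x y) :
    Acts (g * h) x w := by
  rw [acts_iff] at hg hh ⊢
  intro C
  obtain ⟨D, hD, hDC⟩ := exists_smul_mem (g.right : H) g.right.2 C.2
  obtain ⟨a, b, hab, h1, h2⟩ := hh ⟨C.1 ⊓ D, C.2.inf hD⟩
  obtain ⟨b', c, hbc, h3, h4⟩ := hg ⟨C.1 ⊓ D, C.2.inf hD⟩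
  have hd : (g.right : H) • ((b : V) - b') ∈ C.1 :=
    hDC _ (mk_eq_mk.1 (h3.symm.trans h2)).2
  rw [← affine_sub, ← hbc] at hd
  have hgb : affine g (b : V) ∈ σ.A := by
    have := σ.A.add_mem (C.2.le hd) c.2
    simpa using this
  refine ⟨a, ⟨_, hgb⟩, by rw [affine_mul, ← hab], x.compat _ C inf_le_left a h1, ?_⟩
  rw [w.compat _ C inf_le_left c h4, mk_eq_mk]
  exact hd

/-! ### The partial transformation groupoid -/

/-- The partial transformation groupoid `(V ⋊ ⟨S⟩) ⋉ Ā`: its objects are the points of the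
completion `Ā`, and an arrow from `x` to `y` is an element `g` with `g.x = y`, i.e. the pair
`(g, x)`. Composition is `(g, h.x) (h, x) = (g h, x)`. -/
instance : CategoryTheory.Groupoid σ.Completion where
  Hom x y := {g : σ.AffGroup // Acts g x y}
  id x := ⟨1, Acts.refl x⟩
  comp f g := ⟨g.1 * f.1, g.2.mul f.2⟩
  id_comp f := Subtype.ext (mul_one f.1)
  comp_id f := Subtype.ext (one_mul f.1)
  assoc f g h := Subtype.ext (mul_assoc h.1 g.1 f.1).symm
  inv f := ⟨f.1⁻¹, f.2.inv⟩
  inv_comp f := Subtype.ext (mul_inv_cancel f.1)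
  comp_inv f := Subtype.ext (inv_mul_cancel f.1)

/-- The topology on the arrows `(g, x)` is the subspace topology from the product of the discrete
group `V ⋊ ⟨S⟩` and the completion. -/
instance : TopologicalSpace (CategoryTheory.Arrow σ.Completion) :=
  TopologicalSpace.induced (fun f => (f.hom.1 : σ.AffGroup)) ⊥ ⊓
    TopologicalSpace.induced (fun f => (f.left : σ.Completion)) inferInstance

end AlgebraicAction

open CategoryTheory in
/-- Isomorphism of topological groupoids: mutually inverse functors which are continuous on the
spaces of arrows. -/
def TopGroupoidIso (X Y : Type*) [Groupoid X] [Groupoid Y] [TopologicalSpace (Arrow X)]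
    [TopologicalSpace (Arrow Y)] : Prop :=
  ∃ (F : X ⥤ Y) (G : Y ⥤ X), F ⋙ G = 𝟭 X ∧ G ⋙ F = 𝟭 Y ∧
    Continuous (fun f : Arrow X => F.mapArrow.obj f) ∧
    Continuous (fun f : Arrow Y => G.mapArrow.obj f)

/-! ### Algebraic actions from rings -/

section Ring

variable {R : Type*} [Ring R]

/-- The embedding of `R` into `ℚ R = ℚ ⊗ R`, `a ↦ 1 ⊗ a`. -/
def toRat (R : Type*) [Ring R] : R →+* ℚ ⊗[ℤ] R :=
  (Algebra.TensorProduct.includeRight : R →ₐ[ℤ] ℚ ⊗[ℤ] R).toRingHom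

/-- The monoid of left regular elements of `R`: those `a` for which `x ↦ a x` is injective. -/
def leftRegular (R : Type*) [Ring R] : Submonoid R where
  carrier := {a | IsLeftRegular a}
  one_mem' := isRegular_one.left
  mul_mem' := IsLeftRegular.mul

/-- The image of the submonoid `M` of `R` in the unit group of `ℚ R`. -/
def unitMonoid (M : Submonoid R) : Submonoid (ℚ ⊗[ℤ] R)ˣ :=
  (M.map (toRat R : R →* ℚ ⊗[ℤ] R)).comap (Units.coeHom (ℚ ⊗[ℤ] R))

/-- The subgroup `⟨M⟩` of the unit group of `ℚ R` generated by `M`. -/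
def gpOf (M : Submonoid R) : Subgroup (ℚ ⊗[ℤ] R)ˣ :=
  Subgroup.closure (unitMonoid M : Set (ℚ ⊗[ℤ] R)ˣ)

/-- The algebraic action of `M` on an `M`-invariant additive subgroup `L` of `R` by left
multiplication, together with its globalization given by `⟨M⟩` acting on `ℚ R`. The associated
groupoid is `(ℚ R ⋊ ⟨M⟩) ⋉ L̄`. -/
def ringAction (M : Submonoid R) (L : AddSubgroup R) (hL : ∀ a ∈ M, ∀ x ∈ L, a * x ∈ L) :
    AlgebraicAction (ℚ ⊗[ℤ] R)ˣ (ℚ ⊗[ℤ] R) where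
  S := unitMonoid M
  A := L.map (toRat R : R →+ ℚ ⊗[ℤ] R)
  smul_mem := by
    rintro u ⟨a, ha, hu⟩ _ ⟨x, hx, rfl⟩
    refine ⟨a * x, hL a ha x hx, ?_⟩
    have hu' : (u : ℚ ⊗[ℤ] R) = toRat R a := hu.symm
    rw [Units.smul_def, smul_eq_mul, hu']
    exact map_mul (toRat R) a x

theorem toRat_injective [IsAddTorsionFree R] : Function.Injective (toRat R) :=
  Algebra.TensorProduct.includeRight_injective (RingHom.injective_int (algebraMap ℤ ℚ))

theorem left_injective {a : R} (ha : IsLeftRegular a) :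
    Function.Injective (fun v : ℚ ⊗[ℤ] R => toRat R a * v) := by
  have h := Module.Flat.lTensor_preserves_injective_linearMap (M := ℚ)
    (LinearMap.mulLeft ℤ a) ha
  convert h using 1
  ext v
  induction v with
  | zero => simp
  | add v w hv hw => rw [mul_add, map_add, hv, hw]
  | tmul q x => simp [toRat]

/-- In a torsion-free ring of finite rank, left regular elements are invertible in `ℚ R`, so that
`unitMonoid M` is a copy of `M` for every monoid `M` of left regular elements. -/
theorem isUnit_toRat [Module.Finite ℤ R] {a : R} (ha : IsLeftRegular a) :
    IsUnit (toRat R a) := by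
  have hinj := left_injective ha
  have hsurj : Function.Surjective (LinearMap.mulLeft ℚ (toRat R a)) :=
    LinearMap.injective_iff_surjective.1 hinj
  obtain ⟨c, hc⟩ := hsurj 1
  have hc' : toRat R a * c = 1 := hc
  refine ⟨⟨toRat R a, c, hc', hinj ?_⟩, rfl⟩
  change toRat R a * (c * toRat R a) = toRat R a * 1
  rw [← mul_assoc, hc', one_mul, mul_one]

/-- The left regular elements generate the whole unit group of `ℚ R`. -/
theorem gpOf_leftRegular [Module.Finite ℤ R] [IsAddTorsionFree R] :
    gpOf (leftRegular R) = ⊤ := by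
  refine (Subgroup.eq_top_iff' _).2 fun u => ?_
  have key : ∀ v : ℚ ⊗[ℤ] R, ∃ (n : ℕ) (x : R), n ≠ 0 ∧ toRat R x = toRat R (n : R) * v := by
    intro v
    induction v with
    | zero => exact ⟨1, 0, one_ne_zero, by simp⟩
    | tmul q x =>
      refine ⟨q.den, q.num * x, q.den_ne_zero, ?_⟩
      have h1 : toRat R (q.num * x) = (q.num : ℚ) ⊗ₜ[ℤ] x := by
        rw [← zsmul_eq_mul, map_zsmul, ← zsmul_one, TensorProduct.smul_tmul]
        exact (TensorProduct.tmul_smul _ _ _).symm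
      have h2 : (q.den : ℚ) * q = q.num := by rw [mul_comm, Rat.mul_den_eq_num]
      rw [h1, map_natCast, ← h2, ← nsmul_eq_mul, ← nsmul_eq_mul, TensorProduct.smul_tmul']
    | add v w hv hw =>
      obtain ⟨m, x, hm, hx⟩ := hv
      obtain ⟨n, y, hn, hy⟩ := hw
      refine ⟨m * n, n * x + m * y, mul_ne_zero hm hn, ?_⟩
      simp only [map_natCast] at hx hy
      simp only [map_add, map_mul, map_natCast, Nat.cast_mul, hx, hy, mul_add, ← mul_assoc]
      rw [← Nat.cast_mul n m, mul_comm n m, Nat.cast_mul]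
  obtain ⟨n, x, hn, hx⟩ := key u
  have hreg : IsLeftRegular (n : R) := fun y z h => by
    have h' : (n : R) * y = n * z := h
    rw [← nsmul_eq_mul, ← nsmul_eq_mul] at h'
    exact nsmul_right_injective hn h'
  obtain ⟨c, hc⟩ := isUnit_toRat hreg
  have hxreg : IsLeftRegular x := fun y z h => by
    apply toRat_injective
    have h' := congrArg (toRat R) h
    simp only [map_mul, hx, ← hc] at h'
    rw [← Units.val_mul] at h'
    exact (c * u).isUnit.mul_left_cancel h'
  have h1 : c ∈ gpOf (leftRegular R) := Subgroup.subset_closure ⟨n, hreg, hc.symm⟩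
  have h2 : c * u ∈ gpOf (leftRegular R) :=
    Subgroup.subset_closure ⟨x, hxreg, by rw [Units.coeHom_apply, Units.val_mul, hc]; exact hx⟩
  simpa using mul_mem (inv_mem h1) h2

end Ring

end AlgAct

/-! An isomorphism `F` of the groupoids sends the arrow (g, x) to an arrow whose group component
c(g, x) is a locally constant cocycle. Constructible subgroups have finite index, so the completion
is compact. As `A` is finitely generated, there is one constructible D such that c(v, x), for all
translations v in `A`, depends only on x modulo D (`exists_cocycle_tr_eq`). Translations by D fix
classes modulo D, so ρ(d) = c(d, x₀) is an injective homomorphism from D to the other affine group.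
Each arrow over there is the image of an arrow here; hence conjugating ρ(d), for small d, by some γ
∈ ⟨S'⟩ or by a small translation amounts to replacing d by η d with η ∈ ⟨S⟩ (`exists_local_hom`).

Semisimplicity makes ρ translation-valued. Let δ(d) be the linear part of ρ(d). The commutator of
ρ(d) with the translation by m·1 is the translation by m(1 - δ(d)), and it is a product of elements
of the commutative group ρ(D). Hence (δ(d') - 1)(δ(d) - 1) = 0. Since ⟨S'⟩ spans the algebra and
permutes these elements up to multiples, (δ(d) - 1) r (δ(d) - 1) = 0 for all r, so δ(d) - 1 lies in
the Jacobson radical, which is zero. Now ρ extends to an injective ℚ-linear map f with γ f(v) = f(η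
v) (`exists_injective_linearMap`). The inverse isomorphism gives equality of dimensions, so f is
bijective and carries left multiplications to left multiplications, which gives the algebra
isomorphism (`exists_algEquiv_of_linearMap`). -/

namespace AlgAct.AlgebraicAction

open CategoryTheory Multiplicative

variable {H V : Type*} [Group H] [AddCommGroup V] [DistribMulAction H V]
variable {H' V' : Type*} [Group H'] [AddCommGroup V'] [DistribMulAction H' V']
variable {σ : AlgebraicAction H V} {τ : AlgebraicAction H' V'}

/-! ### Absorbing actions and compactness -/

variable (σ) in
/-- The group acted upon has full rank: every vector has a nonzero multiple in it. -/
def FullRank : Prop := ∀ v : V, ∃ n : ℕ, n ≠ 0 ∧ n • v ∈ σ.A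

theorem FullRank.constructible (hV : σ.FullRank) {C : AddSubgroup V} (hC : σ.IsConstructible C)
    (v : V) : ∃ n : ℕ, n ≠ 0 ∧ n • v ∈ C := by
  induction hC generalizing v with
  | base => exact hV v
  | image s hs C hC ih =>
    obtain ⟨n, hn, h⟩ := ih (s⁻¹ • v)
    refine ⟨n, hn, n • s⁻¹ • v, h, ?_⟩
    change s • n • s⁻¹ • v = n • v
    rw [smul_comm s n, smul_inv_smul]
  | preimage s hs C hC ih =>
    obtain ⟨n, hn, h⟩ := ih (s • v)
    obtain ⟨m, hm, h'⟩ := hV v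
    refine ⟨m * n, mul_ne_zero hm hn, ?_, ?_⟩
    · rw [mul_comm, mul_smul]; exact nsmul_mem h' n
    · change s • ((m * n) • v) ∈ C
      rw [smul_comm, mul_smul]; exact nsmul_mem h m

/-- The quotient is finitely generated, and it is torsion because constructible subgroups again have
full rank. -/
theorem FullRank.finite_quotient (hV : σ.FullRank) (hfg : σ.A.FG) {C : AddSubgroup V}
    (hC : σ.IsConstructible C) : Finite (σ.A ⧸ C.addSubgroupOf σ.A) := by
  have : AddGroup.FG σ.A := (AddGroup.fg_iff_addSubgroup_fg _).2 hfg
  refine AddCommGroup.finite_of_fg_isAddTorsion _ fun q => ?_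
  obtain ⟨a, rfl⟩ := QuotientAddGroup.mk_surjective q
  obtain ⟨n, hn, h⟩ := hV.constructible hC a
  rw [isOfFinAddOrder_iff_nsmul_eq_zero]
  refine ⟨n, Nat.pos_of_ne_zero hn, ?_⟩
  rw [← QuotientAddGroup.mk_nsmul, QuotientAddGroup.eq_zero_iff]
  exact h

/-- An ultrafilter pushed to a finite quotient is principal. The classes so chosen are compatible,
since any two of them are realized by a common point, and they form its limit. -/
theorem compactSpace_completion (hV : σ.FullRank) (hfg : σ.A.FG) : CompactSpace σ.Completion := by
  refine ⟨isCompact_iff_ultrafilter_le_nhds.2 fun f _ => ?_⟩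
  have key : ∀ C : {C : AddSubgroup V // σ.IsConstructible C},
      ∃ q : σ.A ⧸ C.1.addSubgroupOf σ.A, {x : σ.Completion | x.coset C = q} ∈ f := fun C => by
    have := hV.finite_quotient hfg C.2
    obtain ⟨q, hq⟩ := Ultrafilter.eq_pure_of_finite (f.map fun x => x.coset C)
    refine ⟨q, ?_⟩
    have : {q} ∈ f.map fun x => x.coset C := by rw [hq]; exact Ultrafilter.mem_pure.2 rfl
    exact this
  choose q hq using key
  refine ⟨⟨q, fun C D hCD a ha => ?_⟩, trivial, ?_⟩
  · obtain ⟨x, hx, hx'⟩ := f.nonempty_of_mem (Filter.inter_mem (hq C) (hq D))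
    rw [← hx']
    exact x.compat C D hCD a (Eq.trans hx ha)
  · rw [(nhds_hasBasis _).ge_iff]
    exact fun C _ => hq C

theorem coset_eq_of_le {C D : {C : AddSubgroup V // σ.IsConstructible C}} (h : C.1 ≤ D.1)
    {x y : σ.Completion} (hxy : x.coset C = y.coset C) : x.coset D = y.coset D := by
  obtain ⟨a, ha⟩ := QuotientAddGroup.mk_surjective (y.coset C)
  rw [x.compat C D h a (hxy.trans ha.symm), y.compat C D h a ha.symm]

/-- A locally constant function on the completion factors through one of the finite quotients. -/
theorem exists_uniform (hV : σ.FullRank) (hfg : σ.A.FG) {T : Type*} (c : σ.Completion → T)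
    (hc : ∀ x, ∃ C : {C : AddSubgroup V // σ.IsConstructible C},
      ∀ y, y.coset C = x.coset C → c y = c x) :
    ∃ C : {C : AddSubgroup V // σ.IsConstructible C}, ∀ x y, x.coset C = y.coset C → c x = c y := by
  have := compactSpace_completion hV hfg
  choose C hC using hc
  obtain ⟨t, ht⟩ := CompactSpace.elim_nhds_subcover
    (fun x => {y : σ.Completion | y.coset (C x) = x.coset (C x)})
    (fun x => (nhds_hasBasis x).mem_of_mem trivial)
  have hinf : ∀ t : Finset σ.Completion, ∃ D : {C : AddSubgroup V // σ.IsConstructible C},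
      ∀ x ∈ t, D.1 ≤ (C x).1 := fun t => by
    classical
    induction t using Finset.induction with
    | empty => exact ⟨⟨_, .base⟩, by simp⟩
    | insert a s _ ih =>
      obtain ⟨D, hD⟩ := ih
      refine ⟨⟨(C a).1 ⊓ D.1, (C a).2.inf D.2⟩, fun x hx => ?_⟩
      rcases Finset.mem_insert.1 hx with rfl | hx
      · exact inf_le_left
      · exact inf_le_right.trans (hD x hx)
  obtain ⟨D, hD⟩ := hinf t
  refine ⟨D, fun x y hxy => ?_⟩
  have hx : x ∈ ⋃ x ∈ t, {y : σ.Completion | y.coset (C x) = x.coset (C x)} := by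
    rw [ht]; trivial
  simp only [Set.mem_iUnion] at hx
  obtain ⟨z, hz, hxz⟩ := hx
  have hxz' : x.coset (C z) = z.coset (C z) := hxz
  rw [hC z x hxz', hC z y ((coset_eq_of_le (hD z hz) hxy).symm.trans hxz')]

/-! ### Translations -/

/-- Translation by `v`. -/
abbrev tr (v : V) : σ.AffGroup := SemidirectProduct.inl (ofAdd v)

theorem tr_add (v w : V) : (tr (v + w) : σ.AffGroup) = tr v * tr w := by
  rw [tr, ofAdd_add, map_mul]

theorem mul_tr (h : σ.AffGroup) (v : V) : h * tr v = tr ((h.right : H) • v) * h := by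
  refine SemidirectProduct.ext ?_ ?_
  · rw [SemidirectProduct.mul_left, SemidirectProduct.mul_left]
    simp only [SemidirectProduct.left_inl, SemidirectProduct.right_inl, map_one, MulAut.one_apply]
    rw [mul_comm]
    rfl
  · simp

theorem affine_tr (v w : V) : affine (tr v : σ.AffGroup) w = v + w := by
  simp [affine]

theorem acts_tr {v : V} {x y : σ.Completion} (h : Acts (tr v) x y)
    {C : {C : AddSubgroup V // σ.IsConstructible C}} (hv : v ∈ C.1) : y.coset C = x.coset C := by
  obtain ⟨a, b, hab, h1, h2⟩ := acts_iff.1 h C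
  rw [h1, h2, mk_eq_mk, hab, affine_tr]
  simpa using hv

theorem exists_acts_tr {v : V} (hv : v ∈ σ.A) (x : σ.Completion) : ∃ y, Acts (tr v) x y := by
  rw [exists_acts_iff, mem_closure_iff_nhds_basis (nhds_hasBasis x)]
  intro C _
  obtain ⟨a, ha⟩ := QuotientAddGroup.mk_surjective (x.coset C)
  refine ⟨_, ⟨a, ?_, rfl⟩, ha⟩
  rw [Set.mem_ofPred_eq, affine_tr]
  exact add_mem hv a.2

/-! ### The cocycle of a functor -/

open Classical in
/-- The group component of the image of the arrow `(g, x)` under a functor. -/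
noncomputable def cocycle (F : σ.Completion ⥤ τ.Completion) (g : σ.AffGroup) (x : σ.Completion) : τ.AffGroup :=
  -- The chosen end point is the only possible one, by `Acts.unique`; off the domain of g the value
  -- 1 is a convention.
  if h : ∃ y, Acts g x y then (F.map (⟨g, h.choose_spec⟩ : x ⟶ h.choose)).1 else 1

variable {F : σ.Completion ⥤ τ.Completion} {G : τ.Completion ⥤ σ.Completion}

theorem cocycle_eq {x y : σ.Completion} (f : x ⟶ y) : cocycle F f.1 x = (F.map f).1 := by
  have h : ∃ y, Acts f.1 x y := ⟨y, f.2⟩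
  have aux : ∀ (z : σ.Completion) (hz : Acts f.1 x z),
      (F.map (⟨f.1, hz⟩ : x ⟶ z)).1 = (F.map f).1 := fun z hz => by
    obtain rfl := hz.unique f.2
    rfl
  rw [cocycle, dif_pos h]
  exact aux _ _

theorem cocycle_mul {g h : σ.AffGroup} {x y z : σ.Completion} (hh : Acts h x y)
    (hg : Acts g y z) : cocycle F (g * h) x = cocycle F g y * cocycle F h x := by
  rw [cocycle_eq (F := F) (⟨h, hh⟩ : x ⟶ y), cocycle_eq (F := F) (⟨g, hg⟩ : y ⟶ z)]
  refine (cocycle_eq (F := F) ((⟨h, hh⟩ : x ⟶ y) ≫ (⟨g, hg⟩ : y ⟶ z))).trans ?_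
  rw [F.map_comp]
  rfl

theorem cocycle_one (x : σ.Completion) : cocycle F 1 x = 1 := by
  refine (cocycle_eq (F := F) (𝟙 x)).trans ?_
  rw [F.map_id]
  rfl

theorem acts_cocycle {g : σ.AffGroup} {x y : σ.Completion} (h : Acts g x y) :
    Acts (cocycle F g x) (F.obj x) (F.obj y) := by
  rw [cocycle_eq (F := F) (⟨g, h⟩ : x ⟶ y)]
  exact (F.map _).2

theorem eqToHom_val {x y : σ.Completion} (h : x = y) : (eqToHom h : x ⟶ y).1 = (1 : σ.AffGroup) := by
  subst h
  rfl

theorem comp_val {x y z : σ.Completion} (f : x ⟶ y) (g : y ⟶ z) : (f ≫ g).1 = g.1 * f.1 := rfl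

theorem cocycle_cocycle (hFG : F ⋙ G = 𝟭 _) {g : σ.AffGroup} {x y : σ.Completion}
    (h : Acts g x y) : cocycle G (cocycle F g x) (F.obj x) = g := by
  rw [cocycle_eq (F := F) (⟨g, h⟩ : x ⟶ y), cocycle_eq]
  have := Functor.congr_hom hFG (⟨g, h⟩ : x ⟶ y)
  rw [Functor.comp_map] at this
  rw [this]
  rw [comp_val, comp_val, eqToHom_val, eqToHom_val, one_mul, mul_one]
  rfl

/-! ### Local constancy of the cocycle -/

theorem nhds_arrow_hasBasis {x y : σ.Completion} (f : x ⟶ y) :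
    (nhds (Arrow.mk f)).HasBasis (fun _ : {C : AddSubgroup V // σ.IsConstructible C} => True)
      (fun C => {k | k.hom.1 = f.1 ∧ k.left.coset C = x.coset C}) := by
  let _ : TopologicalSpace σ.AffGroup := ⊥
  have : DiscreteTopology σ.AffGroup := ⟨rfl⟩
  have h : nhds (Arrow.mk f) =
      Filter.principal {k : Arrow σ.Completion | k.hom.1 = f.1} ⊓
        Filter.comap (fun k : Arrow σ.Completion => (k.left : σ.Completion)) (nhds x) := by
    refine (@nhds_inf _ (TopologicalSpace.induced _ _) (TopologicalSpace.induced _ _) _).trans ?_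
    rw [nhds_induced, nhds_induced, nhds_discrete, Filter.comap_pure]
    rfl
  rw [h]
  exact ((nhds_hasBasis x).comap _).principal_inf _

theorem exists_cocycle_eq (hF : Continuous fun f : Arrow σ.Completion => F.mapArrow.obj f)
    {g : σ.AffGroup} {x y : σ.Completion} (h : Acts g x y)
    (E : {C : AddSubgroup V' // τ.IsConstructible C}) :
    ∃ C : {C : AddSubgroup V // σ.IsConstructible C}, ∀ x' y', Acts g x' y' →
      x'.coset C = x.coset C → cocycle F g x' = cocycle F g x ∧
        (F.obj x').coset E = (F.obj x).coset E := by
  obtain ⟨C, -, hC⟩ := ((nhds_arrow_hasBasis (⟨g, h⟩ : x ⟶ y)).tendsto_iff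
    (nhds_arrow_hasBasis (F.map (⟨g, h⟩ : x ⟶ y)))).1 (hF.tendsto _) E trivial
  refine ⟨C, fun x' y' h' hx => ?_⟩
  obtain ⟨h1, h2⟩ := hC (Arrow.mk (⟨g, h'⟩ : x' ⟶ y')) ⟨rfl, hx⟩
  refine ⟨?_, h2⟩
  rw [cocycle_eq (F := F) (⟨g, h⟩ : x ⟶ y), cocycle_eq (F := F) (⟨g, h'⟩ : x' ⟶ y')]
  exact h1

/-- On translations, the cocycle factors through one of the finite quotients. -/
theorem exists_cocycle_tr_eq (hV : σ.FullRank) (hfg : σ.A.FG)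
    (hF : Continuous fun f : Arrow σ.Completion => F.mapArrow.obj f) :
    ∃ D : {C : AddSubgroup V // σ.IsConstructible C}, ∀ v ∈ σ.A, ∀ x y : σ.Completion,
      x.coset D = y.coset D → cocycle F (tr v) x = cocycle F (tr v) y := by
  have single : ∀ v ∈ σ.A, ∃ D : {C : AddSubgroup V // σ.IsConstructible C},
      ∀ x y : σ.Completion, x.coset D = y.coset D →
        cocycle F (tr v) x = cocycle F (tr v) y := fun v hv => by
    refine exists_uniform hV hfg _ fun x => ?_
    obtain ⟨z, hz⟩ := exists_acts_tr hv x
    obtain ⟨C, hC⟩ := exists_cocycle_eq hF hz ⟨_, .base⟩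
    refine ⟨C, fun y hy => ?_⟩
    obtain ⟨w, hw⟩ := exists_acts_tr hv y
    exact (hC y w hw hy).1
  obtain ⟨S, hS⟩ := hfg
  have hSA : ∀ v ∈ S, v ∈ σ.A := fun v hv => hS ▸ AddSubgroup.subset_closure hv
  have fin : ∀ t : Finset V, (∀ v ∈ t, v ∈ σ.A) →
      ∃ D : {C : AddSubgroup V // σ.IsConstructible C}, ∀ v ∈ t, ∀ x y : σ.Completion,
        x.coset D = y.coset D → cocycle F (tr v) x = cocycle F (tr v) y := fun t => by
    classical
    induction t using Finset.induction with
    | empty => exact fun _ => ⟨⟨_, .base⟩, by simp⟩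
    | insert a s _ ih =>
      intro ht
      obtain ⟨D, hD⟩ := ih fun v hv => ht v (Finset.mem_insert_of_mem hv)
      obtain ⟨D', hD'⟩ := single a (ht a (Finset.mem_insert_self a s))
      refine ⟨⟨D.1 ⊓ D'.1, D.2.inf D'.2⟩, fun v hv x y hxy => ?_⟩
      rcases Finset.mem_insert.1 hv with rfl | hv
      · exact hD' x y (coset_eq_of_le inf_le_right hxy)
      · exact hD v hv x y (coset_eq_of_le inf_le_left hxy)
  obtain ⟨D, hD⟩ := fin S hSA
  -- Translations preserve congruence modulo D, so the bound D found for the generators serves all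
  -- of `A`.
  have acts_congr : ∀ v ∈ σ.A, ∀ {x y x' y' : σ.Completion}, Acts (tr v) x x' →
      Acts (tr v) y y' → x.coset D = y.coset D → x'.coset D = y'.coset D := by
    intro v hv x y x' y' h h' hxy
    obtain ⟨a, b, hab, h1, h2⟩ := acts_iff.1 h D
    obtain ⟨a', b', hab', h1', h2'⟩ := acts_iff.1 h' D
    rw [h2, h2', mk_eq_mk, hab, hab', affine_sub]
    simpa using mk_eq_mk.1 ((h1.symm.trans hxy).trans h1')
  refine ⟨D, fun v hv => ?_⟩
  rw [← hS] at hv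
  induction hv using AddSubgroup.closure_induction with
  | mem v hv => exact hD v hv
  | zero =>
    intro x y _
    have : (tr 0 : σ.AffGroup) = 1 := map_one _
    rw [this, cocycle_one, cocycle_one]
  | add v w hv hw ihv ihw =>
    rw [hS] at hv hw
    intro x y hxy
    obtain ⟨x', hx⟩ := exists_acts_tr hw x
    obtain ⟨y', hy⟩ := exists_acts_tr hw y
    obtain ⟨_, hx'⟩ := exists_acts_tr hv x'
    obtain ⟨_, hy'⟩ := exists_acts_tr hv y'
    rw [tr_add, cocycle_mul hx hx', cocycle_mul hy hy', ihw x y hxy,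
      ihv x' y' (acts_congr w hw hx hy hxy)]
  | neg v hv ih =>
    rw [hS] at hv
    intro x y hxy
    have hinv : (tr (-v) : σ.AffGroup) = (tr v)⁻¹ := by rw [tr, ofAdd_neg, map_inv]
    obtain ⟨x', hx⟩ := exists_acts_tr (neg_mem hv) x
    obtain ⟨y', hy⟩ := exists_acts_tr (neg_mem hv) y
    have e := ih x' y' (acts_congr _ (neg_mem hv) hx hy hxy)
    have key : ∀ {x x' : σ.Completion}, Acts (tr (-v)) x x' →
        cocycle F (tr (-v)) x = (cocycle F (tr v) x')⁻¹ := fun {x x'} h => by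
      have h' := h.inv
      rw [hinv, inv_inv] at h'
      have := cocycle_mul (F := F) h h'
      rw [hinv, mul_inv_cancel, cocycle_one, ← hinv] at this
      exact (inv_eq_of_mul_eq_one_right this.symm).symm
    rw [key hx, key hy, e]

/-- Conjugation by the image of an arrow `(h, x)` on the values of the cocycle on small
translations. -/
theorem exists_conj (hF : Continuous fun f : Arrow σ.Completion => F.mapArrow.obj f)
    {D : {C : AddSubgroup V // σ.IsConstructible C}}
    (hD : ∀ v ∈ σ.A, ∀ x y : σ.Completion, x.coset D = y.coset D →
      cocycle F (tr v) x = cocycle F (tr v) y)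
    {h : σ.AffGroup} {x x' : σ.Completion} (hx : Acts h x x') (hxx' : x'.coset D = x.coset D) :
    ∃ D' : AddSubgroup V, σ.IsConstructible D' ∧ ∀ d ∈ D', d ∈ D.1 ∧ (h.right : H) • d ∈ D.1 ∧
      cocycle F h x * cocycle F (tr d) x * (cocycle F h x)⁻¹ =
        cocycle F (tr ((h.right : H) • d)) x := by
  obtain ⟨C, hC⟩ := exists_cocycle_eq hF hx ⟨_, .base⟩
  obtain ⟨E, hE, hED⟩ := exists_smul_mem (h.right : H) h.right.2 D.2
  -- C keeps the cocycle of h constant near x, and E makes h map d into D.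
  refine ⟨D.1 ⊓ C.1 ⊓ E, (D.2.inf C.2).inf hE, fun d hd => ⟨hd.1.1, hED d hd.2, ?_⟩⟩
  have hdA := D.2.le hd.1.1
  have hdA' := D.2.le (hED d hd.2)
  obtain ⟨y, hy⟩ := exists_acts_tr hdA x
  obtain ⟨y', hy'⟩ := exists_acts_tr hdA' x'
  have hyy' : Acts h y y' := by
    have := (hy'.mul hx).mul hy.inv
    rwa [← mul_tr, mul_inv_cancel_right] at this
  -- The cocycle of h·d = (h d)·h is computed along both paths from x to y'.
  have e1 := cocycle_mul (F := F) hy hyy'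
  rw [mul_tr, cocycle_mul hx hy', (hC y y' hyy' (acts_tr hy hd.1.2)).1, hD _ hdA' x' x hxx'] at e1
  rw [← e1, mul_inv_cancel_right]

/-! ### The local homomorphism given by an isomorphism -/

/-- An isomorphism of the groupoids yields a homomorphism, on a constructible subgroup, into the
affine group on the other side, which is compatible with conjugation by `⟨S⟩` and by small
translations. -/
theorem exists_local_hom (hV : σ.FullRank) (hfg : σ.A.FG)
    (hiso : TopGroupoidIso σ.Completion τ.Completion) :
    ∃ (D : AddSubgroup V) (ρ : V → τ.AffGroup), σ.IsConstructible D ∧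
      (∀ d ∈ D, ∀ d' ∈ D, ρ (d + d') = ρ d * ρ d') ∧ (∀ d ∈ D, ρ d = 1 → d = 0) ∧
      (∀ γ : τ.gp, ∃ η ∈ σ.gp, ∃ D' : AddSubgroup V, σ.IsConstructible D' ∧
        ∀ d ∈ D', d ∈ D ∧ η • d ∈ D ∧
          SemidirectProduct.inr γ * ρ d * (SemidirectProduct.inr γ)⁻¹ = ρ (η • d)) ∧
      ∃ E : AddSubgroup V', τ.IsConstructible E ∧ ∀ e ∈ E,
        ∃ η ∈ σ.gp, ∃ D' : AddSubgroup V, σ.IsConstructible D' ∧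
          ∀ d ∈ D', d ∈ D ∧ η • d ∈ D ∧ tr e * ρ d * (tr e)⁻¹ = ρ (η • d) := by
  obtain ⟨F, G, hFG, hGF, hF, hG⟩ := hiso
  obtain ⟨D, hD⟩ := exists_cocycle_tr_eq hV hfg hF
  -- The image of 0 is fixed by every γ in the enveloping group, so conjugation by γ needs no
  -- smallness condition on γ.
  set y₀ : τ.Completion := τ.toCompletion 0
  set x₀ := G.obj y₀
  have conj : ∀ (g : τ.AffGroup) (y : τ.Completion), Acts g y₀ y →
      (G.obj y).coset D = x₀.coset D →
      ∃ η ∈ σ.gp, ∃ D' : AddSubgroup V, σ.IsConstructible D' ∧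
        ∀ d ∈ D', d ∈ D.1 ∧ η • d ∈ D.1 ∧
          g * cocycle F (tr d) x₀ * g⁻¹ = cocycle F (tr (η • d)) x₀ := fun g y hg hy => by
    -- The arrow (g, y₀) is pulled back by `G`; applying `F` to the result recovers g.
    have h := exists_conj hF hD (acts_cocycle (F := G) hg) hy
    have e : cocycle F (cocycle G g y₀) (G.obj y₀) = g := cocycle_cocycle hGF hg
    rw [e] at h
    exact ⟨_, (cocycle G g y₀).right.2, h⟩
  refine ⟨D.1, fun d => cocycle F (tr d) x₀, D.2, ?_, ?_, ?_, ?_⟩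
  · intro d hd d' hd'
    obtain ⟨y, hy⟩ := exists_acts_tr (D.2.le hd') x₀
    obtain ⟨z, hz⟩ := exists_acts_tr (D.2.le hd) y
    change cocycle F (tr (d + d')) x₀ = _
    rw [tr_add, cocycle_mul hy hz, hD d (D.2.le hd) y x₀ (acts_tr hy hd')]
  · intro d hd h
    obtain ⟨y, hy⟩ := exists_acts_tr (D.2.le hd) x₀
    have e := cocycle_cocycle hFG hy
    rw [show cocycle F (tr d) x₀ = 1 from h, cocycle_one] at e
    have := congrArg (fun g : σ.AffGroup => toAdd g.left) e.symm
    simpa using this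
  · intro γ
    refine conj (SemidirectProduct.inr γ) y₀ (acts_toCompletion ?_) rfl
    simp [affine]
  -- Continuity at the identity arrow of y₀: translations by E move `G.obj y₀` only within its class
  -- modulo D.
  · obtain ⟨E, hE⟩ := exists_cocycle_eq hG (Acts.refl y₀) D
    refine ⟨E.1, E.2, fun e he => ?_⟩
    obtain ⟨y, hy⟩ := exists_acts_tr (E.2.le he) y₀
    exact conj _ y hy (hE y y (Acts.refl y) (acts_tr hy he)).2

end AlgAct.AlgebraicAction

/-! ### Extension to rational linear maps -/

namespace AlgAct

/-- The extension sends v to w(n v)/n for any n ≠ 0 with n v ∈ D; additivity of w makes this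
independent of n. -/
theorem exists_linearMap_extending {V W : Type*} [AddCommGroup V] [Module ℚ V] [AddCommGroup W]
    [Module ℚ W] (D : AddSubgroup V) (hD : ∀ v : V, ∃ n : ℕ, n ≠ 0 ∧ n • v ∈ D) (w : V → W)
    (hw : ∀ d ∈ D, ∀ d' ∈ D, w (d + d') = w d + w d') :
    ∃ f : V →ₗ[ℚ] W, ∀ d ∈ D, f d = w d := by
  have w_zero : w 0 = 0 := by simpa using hw 0 D.zero_mem 0 D.zero_mem
  have w_nsmul : ∀ (n : ℕ), ∀ d ∈ D, w (n • d) = n • w d := fun n d hd => by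
    induction n with
    | zero => simp [w_zero]
    | succ n ih => rw [succ_nsmul, hw _ (nsmul_mem hd n) _ hd, ih, succ_nsmul]
  choose n hn hnD using hD
  have key : ∀ (v : V) (k : ℕ), k ≠ 0 → k • v ∈ D →
      ((n v : ℚ)⁻¹ • w (n v • v)) = (k : ℚ)⁻¹ • w (k • v) := fun v k hk hv => by
    have hk' : (k : ℚ) ≠ 0 := Nat.cast_ne_zero.2 hk
    have hn' : (n v : ℚ) ≠ 0 := Nat.cast_ne_zero.2 (hn v)
    rw [inv_smul_eq_iff₀ hn', smul_comm, eq_inv_smul_iff₀ hk', Nat.cast_smul_eq_nsmul,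
      Nat.cast_smul_eq_nsmul, ← w_nsmul _ _ (hnD v), ← w_nsmul _ _ hv, smul_comm]
  let f : V →+ W :=
    { toFun := fun v => (n v : ℚ)⁻¹ • w (n v • v)
      map_zero' := by simp [w_zero]
      map_add' := fun v v' => by
        have h1 : (n v * n v') • v ∈ D := by rw [mul_comm, mul_smul]; exact nsmul_mem (hnD v) _
        have h2 : (n v * n v') • v' ∈ D := by rw [mul_smul]; exact nsmul_mem (hnD v') _
        have h0 := mul_ne_zero (hn v) (hn v')
        rw [key v _ h0 h1, key v' _ h0 h2, key (v + v') _ h0 (by rw [smul_add]; exact add_mem h1 h2),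
          smul_add, hw _ h1 _ h2, smul_add] }
  refine ⟨f.toRatLinearMap, fun d hd => ?_⟩
  change (n d : ℚ)⁻¹ • w (n d • d) = w d
  rw [key d 1 one_ne_zero (by simpa using hd)]
  simp

theorem TopGroupoidIso.symm {X Y : Type*} [CategoryTheory.Groupoid X] [CategoryTheory.Groupoid Y]
    [TopologicalSpace (CategoryTheory.Arrow X)] [TopologicalSpace (CategoryTheory.Arrow Y)]
    (h : TopGroupoidIso X Y) : TopGroupoidIso Y X := by
  obtain ⟨F, G, h1, h2, h3, h4⟩ := h
  exact ⟨G, F, h2, h1, h4, h3⟩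

/-! ### From the local homomorphism to an algebra isomorphism -/

namespace AlgebraicAction

open Multiplicative

variable {B₁ B₂ : Type*} [Ring B₁] [Ring B₂] [Algebra ℚ B₁] [Algebra ℚ B₂]
variable {σ : AlgebraicAction B₁ˣ B₁} {τ : AlgebraicAction B₂ˣ B₂}

theorem eq_zero_of_nsmul {B : Type*} [Ring B] [Algebra ℚ B] {k : ℕ} (hk : k ≠ 0) {x : B}
    (h : k • x = 0) : x = 0 := by
  rw [← Nat.cast_smul_eq_nsmul ℚ] at h
  exact (smul_eq_zero.1 h).resolve_left (Nat.cast_ne_zero.2 hk)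

/-- An isomorphism of the groupoids yields an injective linear map that intertwines the actions of
the enveloping groups. -/
theorem exists_injective_linearMap (hV₁ : σ.FullRank) (hfg₁ : σ.A.FG) (hV₂ : τ.FullRank)
    (hjac : Ring.jacobson B₂ = ⊥)
    (hspan : Submodule.span ℚ (Units.val '' (τ.gp : Set B₂ˣ)) = ⊤)
    (hiso : TopGroupoidIso σ.Completion τ.Completion) :
    ∃ f : B₁ →ₗ[ℚ] B₂, Function.Injective f ∧
      ∀ γ ∈ τ.gp, ∃ η ∈ σ.gp, ∀ v, (γ : B₂) * f v = f ((η : B₁) * v) := by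
  obtain ⟨D, ρ, hD, hadd, hinj, hgp, E, hE, htr⟩ := exists_local_hom hV₁ hfg₁ hiso
  -- The element 1 itself need not lie in E, but a nonzero multiple does, and m cancels over ℚ.
  obtain ⟨m, hm, hmE⟩ := hV₂.constructible hE 1
  obtain ⟨η₀, -, D', hD', htr⟩ := htr _ hmE
  have hD'D : D' ≤ D := fun d hd => (htr d hd).1
  let δ : B₁ → B₂ := fun d => ((ρ d).right : B₂ˣ)
  have δ_add : ∀ d ∈ D, ∀ d' ∈ D, δ (d + d') = δ d * δ d' := fun d hd d' hd' => by
    simp [δ, hadd d hd d' hd']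
  have unip : ∀ d' ∈ D, ∀ d ∈ D', (δ d' - 1) * (δ d - 1) = 0 := fun d' hd' d hd => by
    obtain ⟨h1, h2, h3⟩ := htr d hd
    have comm : ∀ a ∈ D, Commute (ρ d') (ρ a) := fun a ha => by
      rw [commute_iff_eq, ← hadd _ hd' _ ha, ← hadd _ ha _ hd', add_comm]
    -- The commutator equals ρ(η₀ d) ρ(d)⁻¹, and ρ(D) is commutative.
    have hc : Commute (ρ d') (tr (m • 1) * ρ d * (tr (m • 1))⁻¹ * (ρ d)⁻¹) := by
      rw [h3]
      exact (comm _ h2).mul_right (comm _ h1).inv_right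
    have hu : tr (m • 1) * ρ d * (tr (m • 1))⁻¹ * (ρ d)⁻¹ =
        (tr (m • 1 - δ d * m • 1) : τ.AffGroup) := by
      have h : (tr (m • 1 : B₂) : τ.AffGroup)⁻¹ = tr (-(m • 1)) := by rw [tr, tr, ofAdd_neg, map_inv]
      rw [h, mul_assoc (tr _), mul_tr, ← mul_assoc, mul_inv_cancel_right, ← tr_add]
      congr 2
      rw [Units.smul_def, smul_eq_mul, mul_neg, sub_eq_add_neg]
    rw [hu, commute_iff_eq, mul_tr] at hc
    have h4 := SemidirectProduct.inl_injective (mul_right_cancel hc)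
    -- An affine element commutes with a translation exactly when its linear part fixes the
    -- translation vector.
    have h5 : δ d' * (m • 1 - δ d * m • 1) = m • 1 - δ d * m • 1 := ofAdd.injective h4
    refine eq_zero_of_nsmul hm ?_
    rw [mul_smul_comm, mul_one] at h5
    have h6 : m • ((δ d' - 1) * (δ d - 1)) =
        (m • 1 - m • δ d) - δ d' * (m • 1 - m • δ d) := by
      simp only [← smul_sub, mul_smul_comm]
      congr 1
      noncomm_ring
    rw [h6, h5, sub_self]
  -- The products in `unip` vanish, so d ↦ δ(d) - 1 turns sums into sums.
  have δ_nsmul : ∀ d ∈ D', ∀ k : ℕ, δ (k • d) - 1 = k • (δ d - 1) := fun d hd k => by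
    induction k with
    | zero =>
      have h1 : (ρ 0) = 1 := by simpa using hadd 0 D.zero_mem 0 D.zero_mem
      simp [δ, h1]
    | succ k ih =>
      have hk := nsmul_mem hd k
      have h := unip _ (hD'D hk) _ hd
      rw [succ_nsmul, δ_add _ (hD'D hk) _ (hD'D hd), succ_nsmul, ← ih, ← sub_eq_zero, ← h]
      noncomm_ring
  -- The vector v is scaled until both it and its image under η are small; η does not depend on v.
  have conj : ∀ γ : τ.gp, ∃ η ∈ σ.gp, ∀ v : B₁, ∃ k : ℕ, k ≠ 0 ∧ k • v ∈ D' ∧ η • (k • v) ∈ D' ∧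
      SemidirectProduct.inr γ * ρ (k • v) = ρ (η • (k • v)) * SemidirectProduct.inr γ := fun γ => by
    obtain ⟨η, hη, Dγ, hDγ, h⟩ := hgp γ
    refine ⟨η, hη, fun v => ?_⟩
    obtain ⟨k, hk, hkv⟩ := hV₁.constructible (hDγ.inf hD') v
    obtain ⟨l, hl, hlv⟩ := hV₁.constructible hD' (η • (k • v))
    have e : η • ((l * k) • v) = l • (η • (k • v)) := by rw [mul_smul, smul_comm]
    have hlk : (l * k) • v ∈ Dγ ⊓ D' := by rw [mul_smul]; exact nsmul_mem hkv l
    exact ⟨l * k, mul_ne_zero hl hk, hlk.2, by rwa [e], mul_inv_eq_iff_eq_mul.1 (h _ hlk.1).2.2⟩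
  -- For r = γ in the spanning group, γ moves past δ(d') - 1, up to a multiple, and `unip` applies.
  have nil : ∀ d ∈ D', ∀ d' ∈ D', ∀ r : B₂, (δ d - 1) * r * (δ d' - 1) = 0 := by
    intro d hd d' hd' r
    have hr : r ∈ Submodule.span ℚ (Units.val '' (τ.gp : Set B₂ˣ)) := by rw [hspan]; trivial
    induction hr using Submodule.span_induction with
    | mem r hr =>
      obtain ⟨γ, hγ, rfl⟩ := hr
      obtain ⟨η, -, h⟩ := conj ⟨γ, hγ⟩
      obtain ⟨k, hk, h1, h2, h3⟩ := h d'
      have h4 : (γ : B₂) * δ (k • d') = δ (η • (k • d')) * γ := by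
        have := congrArg (fun g : τ.AffGroup => (((g.right : τ.gp) : B₂ˣ) : B₂)) h3
        simpa using this
      refine eq_zero_of_nsmul hk ?_
      have h5 : (γ : B₂) * (δ (k • d') - 1) = (δ (η • (k • d')) - 1) * γ := by
        rw [mul_sub, h4, sub_mul, mul_one, one_mul]
      rw [← mul_smul_comm, ← δ_nsmul d' hd', mul_assoc, h5, ← mul_assoc,
        unip _ (hD'D hd) _ h2, zero_mul]
    | zero => simp
    | add r s _ _ hr hs => rw [mul_add, add_mul, hr, hs, add_zero]
    | smul q r _ hr => rw [mul_smul_comm, smul_mul_assoc, hr, smul_zero]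
  have δ_one : ∀ d ∈ D', δ d = 1 := fun d hd => by
    have h : δ d - 1 ∈ Ring.jacobson B₂ := by
      rw [← Ideal.jacobson_bot, Ideal.mem_jacobson_iff]
      intro y
      -- With x = δ(d) - 1, the left inverse of 1 + y x is 1 - y x, because x y x = 0.
      refine ⟨1 - y * (δ d - 1), ?_⟩
      have h := nil d hd d hd y
      rw [Ideal.mem_bot]
      calc _ = -(y * ((δ d - 1) * y * (δ d - 1))) := by noncomm_ring
        _ = 0 := by rw [h, mul_zero, neg_zero]
    rw [hjac, Ideal.mem_bot] at h
    exact sub_eq_zero.1 h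
  let w : B₁ → B₂ := fun d => toAdd (ρ d).left
  have ρ_eq : ∀ d ∈ D', ρ d = tr (w d) := fun d hd => by
    refine SemidirectProduct.ext rfl ?_
    exact Subtype.ext (Units.ext (δ_one d hd))
  have w_add : ∀ d ∈ D', ∀ d' ∈ D', w (d + d') = w d + w d' := fun d hd d' hd' => by
    have h := hadd d (hD'D hd) d' (hD'D hd')
    rw [ρ_eq _ hd, ρ_eq _ hd', ρ_eq _ (add_mem hd hd'), ← tr_add] at h
    exact ofAdd.injective (SemidirectProduct.inl_injective h)
  obtain ⟨f, hf⟩ := exists_linearMap_extending D' (hV₁.constructible hD') w w_add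
  refine ⟨f, ?_, fun γ hγ => ?_⟩
  · rw [injective_iff_map_eq_zero]
    intro v hv
    obtain ⟨k, hk, hkv⟩ := hV₁.constructible hD' v
    -- If f kills v, then ρ is trivial at a multiple of v, and ρ has trivial kernel.
    refine eq_zero_of_nsmul hk (hinj _ (hD'D hkv) ?_)
    rw [ρ_eq _ hkv, ← hf _ hkv, map_nsmul, hv, smul_zero]
    exact map_one _
  · obtain ⟨η, hη, h⟩ := conj ⟨γ, hγ⟩
    refine ⟨η, hη, fun v => ?_⟩
    obtain ⟨k, hk, h1, h2, h3⟩ := h v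
    rw [ρ_eq _ h1, ρ_eq _ h2, mul_tr] at h3
    have h4 : (γ : B₂) * w (k • v) = w (η • (k • v)) :=
      ofAdd.injective (SemidirectProduct.inl_injective (mul_right_cancel h3))
    rw [← hf _ h1, ← hf _ h2, Units.smul_def, smul_eq_mul, mul_smul_comm, map_nsmul, map_nsmul,
      mul_smul_comm, ← sub_eq_zero, ← smul_sub] at h4
    exact sub_eq_zero.1 (eq_zero_of_nsmul hk h4)

/-- A linear isomorphism intertwining group actions by multiplication, where the acting group spans,
yields an algebra isomorphism. -/
theorem exists_algEquiv_of_linearMap [FiniteDimensional ℚ B₁] [FiniteDimensional ℚ B₂]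
    {Γ₁ : Subgroup B₁ˣ} {Γ₂ : Subgroup B₂ˣ}
    (hspan : Submodule.span ℚ (Units.val '' (Γ₂ : Set B₂ˣ)) = ⊤)
    (hrank : Module.finrank ℚ B₁ = Module.finrank ℚ B₂) (f : B₁ →ₗ[ℚ] B₂)
    (hf : Function.Injective f)
    (h : ∀ γ ∈ Γ₂, ∃ η ∈ Γ₁, ∀ v, (γ : B₂) * f v = f ((η : B₁) * v)) :
    ∃ φ : B₂ ≃ₐ[ℚ] B₁, ∀ u ∈ Γ₂, Units.map (φ : B₂ →* B₁) u ∈ Γ₁ := by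
  let e : B₁ ≃ₗ[ℚ] B₂ := LinearEquiv.ofInjectiveOfFinrankEq f hf hrank
  have he : ∀ v, e v = f v := fun v => rfl
  -- Conjugation by e turns left multiplication by γ into left multiplication by η, and the elements
  -- b for which such an a exists form a subspace.
  have key : ∀ b : B₂, ∃ a : B₁, ∀ v, b * e v = e (a * v) := fun b => by
    have hb : b ∈ Submodule.span ℚ (Units.val '' (Γ₂ : Set B₂ˣ)) := by rw [hspan]; trivial
    induction hb using Submodule.span_induction with
    | mem r hr =>
      obtain ⟨γ, hγ, rfl⟩ := hr
      obtain ⟨η, -, hη⟩ := h γ hγ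
      exact ⟨η, hη⟩
    | zero => exact ⟨0, by simp⟩
    | add r s _ _ hr hs =>
      obtain ⟨a, ha⟩ := hr
      obtain ⟨b, hb⟩ := hs
      exact ⟨a + b, fun v => by rw [add_mul, ha, hb, add_mul, map_add]⟩
    | smul q r _ hr =>
      obtain ⟨a, ha⟩ := hr
      exact ⟨q • a, fun v => by rw [smul_mul_assoc, ha, smul_mul_assoc, map_smul]⟩
  choose ψ hψ using key
  have uniq : ∀ {a a' : B₁}, (∀ v, e (a * v) = e (a' * v)) → a = a' := fun {a a'} h => by
    simpa using e.injective (h 1)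
  let φ : B₂ →ₐ[ℚ] B₁ := AlgHom.ofLinearMap
    { toFun := ψ
      map_add' := fun a b => uniq fun v => by
        rw [← hψ, add_mul, add_mul, map_add, ← hψ, ← hψ]
      map_smul' := fun q a => uniq fun v => by
        rw [← hψ, smul_mul_assoc, hψ, RingHom.id_apply, smul_mul_assoc, map_smul] }
    (uniq fun v => by
      change e (ψ 1 * v) = _
      rw [← hψ, one_mul, one_mul])
    (fun a b => uniq fun v => by
      change e (ψ (a * b) * v) = e (ψ a * ψ b * v)
      rw [← hψ, mul_assoc, hψ b, hψ a, mul_assoc])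
  have hφ : ∀ b v, b * e v = e (φ b * v) := hψ
  have hinj : Function.Injective φ := by
    rw [injective_iff_map_eq_zero]
    intro b hb
    -- Evaluating at the preimage of 1 recovers b.
    have := hφ b (e.symm 1)
    rwa [e.apply_symm_apply, mul_one, hb, zero_mul, map_zero] at this
  have hsurj : Function.Surjective φ :=
    (LinearMap.injective_iff_surjective_of_finrank_eq_finrank (f := φ.toLinearMap) hrank.symm).1 hinj
  refine ⟨AlgEquiv.ofBijective φ ⟨hinj, hsurj⟩, fun u hu => ?_⟩
  obtain ⟨η, hη, h'⟩ := h u hu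
  have : Units.map ((AlgEquiv.ofBijective φ ⟨hinj, hsurj⟩ : B₂ ≃ₐ[ℚ] B₁) : B₂ →* B₁) u = η :=
    Units.ext (uniq fun v => by
      change e (φ u * v) = _
      rw [← hφ, he, he, h'])
  rwa [this]

/-- Injective linear maps in both directions force equal dimensions. Each one then gives the algebra
isomorphism in the direction opposite to its own. -/
theorem exists_algEquiv_of_topGroupoidIso [FiniteDimensional ℚ B₁] [FiniteDimensional ℚ B₂]
    (hV₁ : σ.FullRank) (hfg₁ : σ.A.FG) (hV₂ : τ.FullRank) (hfg₂ : τ.A.FG)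
    (hjac₁ : Ring.jacobson B₁ = ⊥) (hjac₂ : Ring.jacobson B₂ = ⊥)
    (hspan₁ : Submodule.span ℚ (Units.val '' (σ.gp : Set B₁ˣ)) = ⊤)
    (hspan₂ : Submodule.span ℚ (Units.val '' (τ.gp : Set B₂ˣ)) = ⊤)
    (hiso : TopGroupoidIso σ.Completion τ.Completion) :
    (∃ φ : B₁ ≃ₐ[ℚ] B₂, ∀ u ∈ σ.gp, Units.map (φ : B₁ →* B₂) u ∈ τ.gp) ∧
      ∃ φ : B₂ ≃ₐ[ℚ] B₁, ∀ u ∈ τ.gp, Units.map (φ : B₂ →* B₁) u ∈ σ.gp := by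
  obtain ⟨f, hf, h⟩ := exists_injective_linearMap hV₁ hfg₁ hV₂ hjac₂ hspan₂ hiso
  obtain ⟨g, hg, h'⟩ := exists_injective_linearMap hV₂ hfg₂ hV₁ hjac₁ hspan₁ hiso.symm
  have hrank := (LinearMap.finrank_le_finrank_of_injective hf).antisymm
    (LinearMap.finrank_le_finrank_of_injective hg)
  exact ⟨exists_algEquiv_of_linearMap hspan₁ hrank.symm g hg h',
    exists_algEquiv_of_linearMap hspan₂ hrank f hf h⟩

end AlgebraicAction

/-! ### Ring actions -/

section Ring

open AlgebraicAction

variable {R : Type*} [Ring R]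

theorem tmul_eq_smul_toRat (q : ℚ) (x : R) : q ⊗ₜ[ℤ] x = q • toRat R x := by
  simp [toRat, TensorProduct.smul_tmul']

theorem exists_nsmul_eq_toRat (v : ℚ ⊗[ℤ] R) : ∃ (n : ℕ) (x : R), n ≠ 0 ∧ n • v = toRat R x := by
  induction v with
  | zero => exact ⟨1, 0, one_ne_zero, by simp⟩
  | tmul q x =>
    refine ⟨q.den, q.num • x, q.den_ne_zero, ?_⟩
    rw [tmul_eq_smul_toRat, map_zsmul, ← Nat.cast_smul_eq_nsmul ℚ, ← Int.cast_smul_eq_zsmul ℚ,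
      smul_smul, mul_comm, Rat.mul_den_eq_num]
  | add v w hv hw =>
    obtain ⟨m, x, hm, hx⟩ := hv
    obtain ⟨n, y, hn, hy⟩ := hw
    refine ⟨m * n, n • x + m • y, mul_ne_zero hm hn, ?_⟩
    rw [map_add, map_nsmul, map_nsmul, ← hx, ← hy, smul_add, mul_smul, mul_smul, smul_comm m n v]

theorem fullRank_ringAction [Module.Finite ℤ R] {M : Submonoid R} {L : AddSubgroup R}
    {hL : ∀ a ∈ M, ∀ x ∈ L, a * x ∈ L} (h : Module.finrank ℤ L = Module.finrank ℤ R) :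
    (ringAction M L hL).FullRank := by
  intro v
  obtain ⟨n, x, hn, hx⟩ := exists_nsmul_eq_toRat v
  -- The quotient has rank zero, hence is torsion.
  have h0 : Module.finrank ℤ (R ⧸ L.toIntSubmodule) = 0 := by
    have h1 := Submodule.finrank_quotient_add_finrank L.toIntSubmodule
    have h2 : Module.finrank ℤ L.toIntSubmodule = Module.finrank ℤ R := h
    lia
  obtain ⟨a, ha, hax⟩ := Module.finrank_eq_zero_iff.1 h0 (Submodule.Quotient.mk x)
  rw [← Submodule.Quotient.mk_smul, Submodule.Quotient.mk_eq_zero] at hax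
  have hax' : a • x ∈ L := hax
  refine ⟨a.natAbs * n, mul_ne_zero (Int.natAbs_ne_zero.2 ha) hn, a.natAbs • x, ?_, ?_⟩
  · rcases Int.natAbs_eq a with h | h <;> rw [h] at hax'
    · simpa using hax'
    · simpa using hax'
  · rw [mul_smul, hx]
    exact map_nsmul _ _ _

theorem fullRank_ringAction_top [Module.Finite ℤ R] {M : Submonoid R}
    {hL : ∀ a ∈ M, ∀ x ∈ (⊤ : AddSubgroup R), a * x ∈ (⊤ : AddSubgroup R)} :
    (ringAction M ⊤ hL).FullRank :=
  fullRank_ringAction (finrank_top ℤ R)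

theorem fg_ringAction [Module.Finite ℤ R] {M : Submonoid R} {L : AddSubgroup R}
    {hL : ∀ a ∈ M, ∀ x ∈ L, a * x ∈ L} : (ringAction M L hL).A.FG := by
  have h : (L.toIntSubmodule.map (toRat R).toAddMonoidHom.toIntLinearMap).FG :=
    (IsNoetherian.noetherian L.toIntSubmodule).map _
  exact (Submodule.fg_iff_addSubgroup_fg _).1 h

/-- Up to a nonzero integer, each element of ℚ R comes from R, and by finite index from the ℤ-span
of `M`. -/
theorem span_gpOf [Module.Finite ℤ R] {M : Submonoid R} (hM : M ≤ leftRegular R)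
    (h : (Submodule.span ℤ (M : Set R)).toAddSubgroup.FiniteIndex) :
    Submodule.span ℚ (Units.val '' (gpOf M : Set (ℚ ⊗[ℤ] R)ˣ)) = ⊤ := by
  rw [Submodule.eq_top_iff']
  have hmem : ∀ x ∈ Submodule.span ℤ (M : Set R),
      toRat R x ∈ Submodule.span ℚ (Units.val '' (gpOf M : Set (ℚ ⊗[ℤ] R)ˣ)) := fun x hx => by
    induction hx using Submodule.span_induction with
    | mem x hx =>
      obtain ⟨u, hu⟩ := isUnit_toRat (hM hx)
      exact Submodule.subset_span ⟨u, Subgroup.subset_closure ⟨x, hx, hu.symm⟩, hu⟩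
    | zero => simp
    | add x y _ _ hx hy => rw [map_add]; exact add_mem hx hy
    | smul n x _ hx => rw [map_zsmul]; exact zsmul_mem hx n
  intro v
  obtain ⟨n, x, hn, hx⟩ := exists_nsmul_eq_toRat v
  obtain ⟨k, hk, -, hkx⟩ := AddSubgroup.exists_nsmul_mem_of_index_ne_zero h.index_ne_zero x
  have hv := hmem _ hkx
  rw [map_nsmul, ← hx, ← Nat.cast_smul_eq_nsmul ℚ, ← Nat.cast_smul_eq_nsmul ℚ] at hv
  rwa [Submodule.smul_mem_iff _ (by exact_mod_cast hk.ne'),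
    Submodule.smul_mem_iff _ (by exact_mod_cast hn)] at hv

/-- An element v has finitely many eigenvalues, so some rational q makes q - v invertible, and v =
q·1 - (q - v). -/
theorem span_units {B : Type*} [Ring B] [Algebra ℚ B] [FiniteDimensional ℚ B] :
    Submodule.span ℚ (Units.val '' ((⊤ : Subgroup Bˣ) : Set Bˣ)) = ⊤ := by
  rw [Submodule.eq_top_iff']
  intro v
  obtain ⟨q, hq⟩ := (Module.End.finite_spectrum (LinearMap.mulLeft ℚ v)).exists_notMem
  rw [spectrum.notMem_iff] at hq
  have hunit : IsUnit (algebraMap ℚ B q - v) := by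
    rw [← Algebra.lmul_isUnit_iff (R := ℚ), map_sub, AlgHom.commutes]
    exact hq
  obtain ⟨u, hu⟩ := hunit
  have h1 : (1 : B) ∈ Submodule.span ℚ (Units.val '' ((⊤ : Subgroup Bˣ) : Set Bˣ)) :=
    Submodule.subset_span ⟨1, trivial, rfl⟩
  have hv : v = q • 1 - (u : B) := by rw [hu, Algebra.algebraMap_eq_smul_one, sub_sub_cancel]
  rw [hv]
  exact sub_mem (Submodule.smul_mem _ _ h1) (Submodule.subset_span ⟨u, trivial, rfl⟩)

theorem span_gpOf_leftRegular [Module.Finite ℤ R] [IsAddTorsionFree R] :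
    Submodule.span ℚ (Units.val '' (gpOf (leftRegular R) : Set (ℚ ⊗[ℤ] R)ˣ)) = ⊤ := by
  rw [gpOf_leftRegular]
  exact span_units

end Ring

end AlgAct

/-! ### The main theorem -/

open AlgAct in
theorem mainTheorem3 {R₁ : Type*} {R₂ : Type*} [Ring R₁] [Ring R₂]
    [Module.Finite ℤ R₁] [Module.Finite ℤ R₂] [IsAddTorsionFree R₁] [IsAddTorsionFree R₂]
    (hss₁ : Ring.jacobson (ℚ ⊗[ℤ] R₁) = ⊥) (hss₂ : Ring.jacobson (ℚ ⊗[ℤ] R₂) = ⊥) :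
    (∀ (M₁ : Submonoid R₁) (M₂ : Submonoid R₂) (L₁ : AddSubgroup R₁) (L₂ : AddSubgroup R₂)
      (hL₁ : ∀ a ∈ M₁, ∀ x ∈ L₁, a * x ∈ L₁) (hL₂ : ∀ a ∈ M₂, ∀ x ∈ L₂, a * x ∈ L₂),
      M₁ ≤ leftRegular R₁ → M₂ ≤ leftRegular R₂ →
      Module.finrank ℤ L₁ = Module.finrank ℤ R₁ → Module.finrank ℤ L₂ = Module.finrank ℤ R₂ →
      (Submodule.span ℤ (M₁ : Set R₁)).toAddSubgroup.FiniteIndex →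
      (Submodule.span ℤ (M₂ : Set R₂)).toAddSubgroup.FiniteIndex →
      (∃ κ₁ : ℤ, κ₁ ≠ 0 ∧ κ₁ ≠ 1 ∧ (κ₁ : R₁) ∈ M₁) →
      (∃ κ₂ : ℤ, κ₂ ≠ 0 ∧ κ₂ ≠ 1 ∧ (κ₂ : R₂) ∈ M₂) →
      TopGroupoidIso (ringAction M₁ L₁ hL₁).Completion (ringAction M₂ L₂ hL₂).Completion →
      ∃ (φ₁ : ℚ ⊗[ℤ] R₁ ≃ₐ[ℚ] ℚ ⊗[ℤ] R₂) (φ₂ : ℚ ⊗[ℤ] R₂ ≃ₐ[ℚ] ℚ ⊗[ℤ] R₁),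
        (∀ u ∈ gpOf M₁, Units.map (φ₁ : ℚ ⊗[ℤ] R₁ →* ℚ ⊗[ℤ] R₂) u ∈ gpOf M₂) ∧
        (∀ u ∈ gpOf M₂, Units.map (φ₂ : ℚ ⊗[ℤ] R₂ →* ℚ ⊗[ℤ] R₁) u ∈ gpOf M₁)) ∧
    (TopGroupoidIso
        (ringAction (leftRegular R₁) ⊤ (fun _ _ _ _ => AddSubgroup.mem_top _)).Completion
        (ringAction (leftRegular R₂) ⊤ (fun _ _ _ _ => AddSubgroup.mem_top _)).Completion →
      Nonempty (ℚ ⊗[ℤ] R₁ ≃ₐ[ℚ] ℚ ⊗[ℤ] R₂)) := by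
  constructor
  · intro M₁ M₂ L₁ L₂ hL₁ hL₂ hM₁ hM₂ hr₁ hr₂ hi₁ hi₂ _ _ hiso
    obtain ⟨⟨φ₁, h₁⟩, φ₂, h₂⟩ := AlgebraicAction.exists_algEquiv_of_topGroupoidIso
      (fullRank_ringAction hr₁) fg_ringAction (fullRank_ringAction hr₂) fg_ringAction hss₁ hss₂
      (span_gpOf hM₁ hi₁) (span_gpOf hM₂ hi₂) hiso
    exact ⟨φ₁, φ₂, h₁, h₂⟩
  · intro hiso
    obtain ⟨⟨φ, -⟩, -⟩ := AlgebraicAction.exists_algEquiv_of_topGroupoidIso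
      (σ := ringAction (leftRegular R₁) ⊤ fun _ _ _ _ => AddSubgroup.mem_top _)
      (τ := ringAction (leftRegular R₂) ⊤ fun _ _ _ _ => AddSubgroup.mem_top _)
      fullRank_ringAction_top fg_ringAction fullRank_ringAction_top fg_ringAction hss₁ hss₂
      span_gpOf_leftRegular span_gpOf_leftRegular hiso
    exact ⟨φ⟩
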